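/- Let $K\in\mathbb{R}\setminus\{0\}$ and set $J:=(-\infty,\tfrac1{2K})$ if $K>0$, $J:=(\tfrac1{2K},\infty)$ if $K<0$. Let $\sigma:J\to\mathbb{R}$ be the increasing bijection $$\sigma(s):=-\frac{1}{2K}\log(1-2Ks),\qquad\text{with inverse}\qquad \sigma^{-1}(t)=\frac{1-e^{-2Kt}}{2K}.$$ Let $\mathcal{T}\in(0,\infty]$, where $\sigma^{-1}(\infty):=\sup J$, and let $(M,g(t))_{t\in[0,\mathcal{T})}$ be a time-dependent Riemannian manifold, that is, $M$ is a smooth finite-dimensional manifold without boundary and $g(t)$ is a family of Riemannian metrics on $M$ which is smooth in $(t,x)\in[0,\mathcal{T})\times M$. For $s\in[0,\sigma^{-1}(\mathcal{T}))$ define $$\overline{g}(s):=e^{-2K\sigma(s)}\,g(\sigma(s)).$$ Then the following are equivalent: 1. $(M,g(t))_{t\in[0,\mathcal{T})}$ is a $K$-Ricci flow, that is, $\tfrac12\partial_t g+\operatorname{Ric}_{g(t)}=K\,g(t)$ on $[0,\mathcal{T})$; 2. $(M,\overline{g}(s))_{s\in[0,\sigma^{-1}(\mathcal{T}))}$ is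 a Ricci flow, that is, it is a time-dependent Riemannian manifold with $\partial_s\overline{g}=-2\operatorname{Ric}_{\overline{g}(s)}$ on $[0,\sigma^{-1}(\mathcal{T}))$. (Time derivatives at the initial time $0$ are one-sided.) -/

import Mathlib

open Set Bundle
open scoped Manifold ContDiff Topology

noncomputable section

/-- Smooth Riemannian metrics on the `n`-dimensional smooth manifold `M` (without boundary). -/
abbrev SmoothMetric (n : ℕ) (M : Type*) [TopologicalSpace M]
    [ChartedSpace (EuclideanSpace ℝ (Fin n)) M] [IsManifold (𝓡 n) ∞ M] :=
  ContMDiffRiemannianMetric (𝓡 n) ∞ (EuclideanSpace ℝ (Fin n))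
    (fun x : M ↦ TangentSpace (𝓡 n) x)

section Geometry

variable {n : ℕ} {M : Type*} [TopologicalSpace M]
  [ChartedSpace (EuclideanSpace ℝ (Fin n)) M] [IsManifold (𝓡 n) ∞ M]

set_option synthInstance.maxHeartbeats 200000 in
/-- The metric `c • g` for a positive constant `c`. -/
def SmoothMetric.scale (c : ℝ) (hc : 0 < c) (g : SmoothMetric n M) : SmoothMetric n M where
  inner x := c • g.inner x
  symm x v w := by simp [g.symm x v w]
  pos x v hv := by
    have := g.pos x v hv
    simpa using mul_pos hc this
  isVonNBounded x := by
    have h := (g.isVonNBounded x).image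
      ((Real.sqrt c)⁻¹ • ContinuousLinearMap.id ℝ (TangentSpace (𝓡 n) x))
    refine h.subset ?_
    intro v hv
    have hs : 0 < Real.sqrt c := Real.sqrt_pos.2 hc
    refine ⟨Real.sqrt c • v, ?_, ?_⟩
    · have hv' : c * g.inner x v v < 1 := by simpa using hv
      have : Real.sqrt c * (Real.sqrt c * g.inner x v v) < 1 := by
        rw [← mul_assoc, Real.mul_self_sqrt hc.le]; exact hv'
      simpa using this
    · simp [smul_smul, hs.ne']
  contMDiff := g.contMDiff.const_smul_section

/-- `∂_k f (y)` for a function `f` on `ℝⁿ`. -/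
def partialDeriv (k : Fin n) (f : EuclideanSpace ℝ (Fin n) → ℝ)
    (y : EuclideanSpace ℝ (Fin n)) : ℝ :=
  fderiv ℝ f y (EuclideanSpace.single k 1)

/-- The coordinate vector field `∂_i` of the chart of `M` around `x₀`, at the point of `M` with
coordinates `y`. -/
def coordVector (x₀ : M) (i : Fin n) (y : EuclideanSpace ℝ (Fin n)) :
    TangentSpace (𝓡 n) ((extChartAt (𝓡 n) x₀).symm y) :=
  mfderiv 𝓘(ℝ, EuclideanSpace ℝ (Fin n)) (𝓡 n) (extChartAt (𝓡 n) x₀).symm y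
    (EuclideanSpace.single i (1 : ℝ) : EuclideanSpace ℝ (Fin n))

/-- The matrix `g_{ij}(y) = g(∂_i, ∂_j)` of `g` in the chart around `x₀`. -/
def metricMatrix (g : SmoothMetric n M) (x₀ : M) (y : EuclideanSpace ℝ (Fin n)) :
    Matrix (Fin n) (Fin n) ℝ :=
  Matrix.of fun i j ↦
    g.inner ((extChartAt (𝓡 n) x₀).symm y) (coordVector x₀ i y) (coordVector x₀ j y)

/-- The Christoffel symbols of the Levi-Civita connection of `g` in the chart around `x₀`:
`Γ^k_{ij} = 1/2 ∑_l g^{kl} (∂_i g_{jl} + ∂_j g_{il} - ∂_l g_{ij})`. -/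
def christoffel (g : SmoothMetric n M) (x₀ : M) (k i j : Fin n)
    (y : EuclideanSpace ℝ (Fin n)) : ℝ :=
  (1 / 2) * ∑ l, (metricMatrix g x₀ y)⁻¹ k l *
    (partialDeriv i (fun z ↦ metricMatrix g x₀ z j l) y
      + partialDeriv j (fun z ↦ metricMatrix g x₀ z i l) y
      - partialDeriv l (fun z ↦ metricMatrix g x₀ z i j) y)

/-- The components of the Ricci tensor of `g` in the chart around `x₀`:
`R_{ij} = ∑_k (∂_k Γ^k_{ij} - ∂_j Γ^k_{ik}) + ∑_{k,l} (Γ^k_{kl} Γ^l_{ij} - Γ^k_{jl} Γ^l_{ik})`.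
With this sign the round sphere has positive Ricci curvature. -/
def ricciCoord (g : SmoothMetric n M) (x₀ : M) (i j : Fin n)
    (y : EuclideanSpace ℝ (Fin n)) : ℝ :=
  ∑ k, (partialDeriv k (christoffel g x₀ k i j) y - partialDeriv j (christoffel g x₀ k i k) y)
    + ∑ k, ∑ l, (christoffel g x₀ k k l y * christoffel g x₀ l i j y
        - christoffel g x₀ k j l y * christoffel g x₀ l i k y)

/-- The `i`-th component of the tangent vector `v` at `x`, in the chart around `x`. -/
def coordComponent (x : M) (v : TangentSpace (𝓡 n) x) (i : Fin n) : ℝ :=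
  let u : EuclideanSpace ℝ (Fin n) :=
    mfderiv (𝓡 n) 𝓘(ℝ, EuclideanSpace ℝ (Fin n)) (extChartAt (𝓡 n) x) x v
  u i

/-- The Ricci curvature `Ric_x(v, w) = ∑_{i,j} R_{ij} v^i w^j`, computed in the chart around `x`
(the value does not depend on the chart, `Ric` being a tensor). -/
def ricci (g : SmoothMetric n M) (x : M) (v w : TangentSpace (𝓡 n) x) : ℝ :=
  ∑ i, ∑ j, ricciCoord g x i j (extChartAt (𝓡 n) x x) * coordComponent x v i * coordComponent x w j

/-- `(g t)_{t ∈ I}` is a time-dependent Riemannian metric on `M`: the metrics `g t` depend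
smoothly on `(t, x) ∈ I × M`. The values of `g` outside `I` play no role. -/
def IsTimeDependentMetric (I : Set ℝ) (g : ℝ → SmoothMetric n M) : Prop :=
  ContMDiffOn (𝓘(ℝ, ℝ).prod (𝓡 n))
    ((𝓡 n).prod 𝓘(ℝ, EuclideanSpace ℝ (Fin n) →L[ℝ] EuclideanSpace ℝ (Fin n) →L[ℝ] ℝ)) ∞
    (fun p : ℝ × M ↦
      TotalSpace.mk' (EuclideanSpace ℝ (Fin n) →L[ℝ] EuclideanSpace ℝ (Fin n) →L[ℝ] ℝ)
        (E := fun x : M ↦ TangentSpace (𝓡 n) x →L[ℝ] TangentSpace (𝓡 n) x →L[ℝ] ℝ)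
        p.2 ((g p.1).inner p.2))
    (I ×ˢ univ)

/-- Ricci flow: `∂_t g = -2 Ric` on `I` (one-sided derivative at an end point of `I`). -/
structure IsRicciFlow (I : Set ℝ) (g : ℝ → SmoothMetric n M) : Prop where
  isTimeDependentMetric : IsTimeDependentMetric I g
  evolution : ∀ t ∈ I, ∀ (x : M) (v w : TangentSpace (𝓡 n) x),
    HasDerivWithinAt (fun τ ↦ (g τ).inner x v w) (-2 * ricci (g t) x v w) I t

/-- `K`-Ricci flow: `(1/2) ∂_t g + Ric = K g` on `I` (`h` stands for `∂_t g (v, w)`). -/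
structure IsKRicciFlow (K : ℝ) (I : Set ℝ) (g : ℝ → SmoothMetric n M) : Prop where
  isTimeDependentMetric : IsTimeDependentMetric I g
  evolution : ∀ t ∈ I, ∀ (x : M) (v w : TangentSpace (𝓡 n) x),
    ∃ h : ℝ, HasDerivWithinAt (fun τ ↦ (g τ).inner x v w) h I t ∧
      (1 / 2) * h + ricci (g t) x v w = K * (g t).inner x v w

end Geometry

/-- `σ(s) = -(1/(2K)) log (1 - 2Ks)`, used for `s` in `sigmaDomain K`. -/
def sigma (K s : ℝ) : ℝ := -(1 / (2 * K)) * Real.log (1 - 2 * K * s)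

/-- The domain `J` of `σ`: `(-∞, 1/(2K))` if `K > 0` and `(1/(2K), ∞)` if `K < 0`. -/
def sigmaDomain (K : ℝ) : Set ℝ := if 0 < K then Iio (1 / (2 * K)) else Ioi (1 / (2 * K))

/-- `σ⁻¹(t) = (1 - exp (-2Kt)) / (2K)`; `sigmaInv_spec` shows that it is the inverse of `σ`. -/
def sigmaInv (K t : ℝ) : ℝ := (1 - Real.exp (-2 * K * t)) / (2 * K)

theorem sigmaInv_spec {K : ℝ} (hK : K ≠ 0) :
    MapsTo (sigmaInv K) univ (sigmaDomain K) ∧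
      InvOn (sigmaInv K) (sigma K) (sigmaDomain K) univ := by
  have h2 : 2 * K ≠ 0 := by simpa using hK
  have key : ∀ t, 1 - 2 * K * sigmaInv K t = Real.exp (-2 * K * t) := by
    intro t; unfold sigmaInv; rw [mul_div_cancel₀ _ h2]; ring
  refine ⟨fun t _ ↦ ?_, fun s hs ↦ ?_, fun t _ ↦ ?_⟩
  · have he := Real.exp_pos (-2 * K * t)
    unfold sigmaDomain sigmaInv
    split_ifs with h
    · exact (div_lt_div_iff_of_pos_right (by linarith : 0 < 2 * K)).2 (by linarith)
    · have : K < 0 := lt_of_le_of_ne (not_lt.1 h) hK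
      exact (div_lt_div_right_of_neg (by linarith : 2 * K < 0)).2 (by linarith)
  · have hpos : 0 < 1 - 2 * K * s := by
      unfold sigmaDomain at hs
      split_ifs at hs with h
      · have := (lt_div_iff₀ (by linarith : 0 < 2 * K)).1 hs
        linarith
      · have hK' : K < 0 := lt_of_le_of_ne (not_lt.1 h) hK
        have := (div_lt_iff_of_neg (by linarith : 2 * K < 0)).1 hs
        linarith
    have : -2 * K * sigma K s = Real.log (1 - 2 * K * s) := by
      unfold sigma; field_simp
    rw [sigmaInv, this, Real.exp_log hpos]
    field_simp
    ring
  · rw [sigma, key, Real.log_exp]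
    field_simp

/-- `σ⁻¹(T)` for an end time `T ∈ (0, ∞]`; for `T = ∞` this is the limit of `σ⁻¹(t)` as `t → ∞`,
that is, the supremum of `J`. -/
def sigmaInvEnd (K : ℝ) (T : EReal) : EReal :=
  if T = ⊤ then (if 0 < K then ((1 / (2 * K) : ℝ) : EReal) else ⊤)
  else ((sigmaInv K T.toReal : ℝ) : EReal)

/-- The time interval `[0, T)`, where `T = ∞` is allowed. -/
def timeInterval (T : EReal) : Set ℝ := {t : ℝ | 0 ≤ t ∧ (t : EReal) < T}

/-- The rescaled family `ḡ(s) = exp (-2Kσ(s)) g(σ(s))`. -/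
def rescaledMetric {n : ℕ} {M : Type*} [TopologicalSpace M]
    [ChartedSpace (EuclideanSpace ℝ (Fin n)) M] [IsManifold (𝓡 n) ∞ M]
    (K : ℝ) (g : ℝ → SmoothMetric n M) (s : ℝ) : SmoothMetric n M :=
  SmoothMetric.scale (Real.exp (-2 * K * sigma K s)) (Real.exp_pos _) (g (sigma K s))

end

/-! ### Ricci curvature under constant rescaling. -/

section ScalingInvariance

/-! On `J` the conformal factor `exp (-2Kσ(s))` equals `1 - 2Ks`, and `σ'(s)` is its reciprocal. The
product and chain rules therefore give `∂_s ḡ = ∂_t g - 2K g` at `t = σ(s)`. Since `Ric` ignores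
constant factors (`ricci_scale`), `∂_t g = 2K g - 2 Ric` becomes `∂_s ḡ = -2 Ric`, and conversely.
Differentiability has to be carried both ways, through `σ` (`HasDerivWithinAt.rescale_comp_sigma`)
and through `σ⁻¹` (`HasDerivWithinAt.of_rescale_comp_sigma`). -/

theorem partialDeriv_const_mul {n : ℕ} (k : Fin n) (c : ℝ)
    (f : EuclideanSpace ℝ (Fin n) → ℝ) (y : EuclideanSpace ℝ (Fin n)) :
    partialDeriv k (fun z ↦ c * f z) y = c * partialDeriv k f y := by
  -- No differentiability is needed: a nonzero scalar preserves non-differentiability, and for `c =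
  -- 0` both sides vanish.
  have h : fderiv ℝ (c • f) y = c • fderiv ℝ f y := congrFun (fderiv_const_smul_field c) y
  have h' : (fun z ↦ c * f z) = c • f := rfl
  rw [partialDeriv, h', h]
  rfl

theorem Matrix.inv_smul_of_ne_zero {ι : Type*} [Fintype ι] [DecidableEq ι] {c : ℝ} (hc : c ≠ 0)
    (A : Matrix ι ι ℝ) : (c • A)⁻¹ = c⁻¹ • A⁻¹ := by
  by_cases hA : IsUnit A.det
  · refine Matrix.inv_eq_right_inv ?_
    rw [Matrix.smul_mul, Matrix.mul_smul, smul_smul, mul_inv_cancel₀ hc, one_smul,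
      Matrix.mul_nonsing_inv A hA]
  -- Singular case: both inverses take the default value `0`.
  · have hA' : ¬ IsUnit (c • A).det := by
      rw [Matrix.det_smul, IsUnit.mul_iff]
      exact fun h ↦ hA h.2
    rw [Matrix.nonsing_inv_apply_not_isUnit _ hA, Matrix.nonsing_inv_apply_not_isUnit _ hA',
      smul_zero]

variable {n : ℕ} {M : Type*} [TopologicalSpace M]
  [ChartedSpace (EuclideanSpace ℝ (Fin n)) M] [IsManifold (𝓡 n) ∞ M]

theorem metricMatrix_scale (c : ℝ) (hc : 0 < c) (g : SmoothMetric n M) (x₀ : M)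
    (y : EuclideanSpace ℝ (Fin n)) :
    metricMatrix (g.scale c hc) x₀ y = c • metricMatrix g x₀ y := rfl

/-- The factor `c⁻¹` from the inverse matrix cancels the `c` from the differentiated metric. -/
theorem christoffel_scale (c : ℝ) (hc : 0 < c) (g : SmoothMetric n M) (x₀ : M) (k i j : Fin n) :
    christoffel (g.scale c hc) x₀ k i j = christoffel g x₀ k i j := by
  ext y
  simp only [christoffel, metricMatrix_scale, Matrix.inv_smul_of_ne_zero hc.ne',
    Matrix.smul_apply, smul_eq_mul, partialDeriv_const_mul]
  congr 1
  refine Finset.sum_congr rfl fun l _ ↦ ?_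
  field_simp

/-- The Ricci tensor does not change when the metric is multiplied by a positive constant. -/
theorem ricci_scale (c : ℝ) (hc : 0 < c) (g : SmoothMetric n M) (x : M)
    (v w : TangentSpace (𝓡 n) x) : ricci (g.scale c hc) x v w = ricci g x v w := by
  simp only [ricci, ricciCoord, christoffel_scale]

end ScalingInvariance

/-! ### The time change `σ` and derivatives along it. -/

section TimeChange

variable {K : ℝ}

theorem one_sub_mul_sigmaInv (hK : K ≠ 0) (t : ℝ) :
    1 - 2 * K * sigmaInv K t = Real.exp (-2 * K * t) := by
  unfold sigmaInv
  field_simp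
  ring

theorem sigma_sigmaInv (hK : K ≠ 0) (t : ℝ) : sigma K (sigmaInv K t) = t :=
  (sigmaInv_spec hK).2.2 (mem_univ t)

theorem sigmaInv_sigma (hK : K ≠ 0) {s : ℝ} (hs : s ∈ sigmaDomain K) :
    sigmaInv K (sigma K s) = s :=
  (sigmaInv_spec hK).2.1 hs

theorem exp_sigma (hK : K ≠ 0) {s : ℝ} (hs : s ∈ sigmaDomain K) :
    Real.exp (-2 * K * sigma K s) = 1 - 2 * K * s := by
  rw [← one_sub_mul_sigmaInv hK, sigmaInv_sigma hK hs]

theorem one_sub_pos_of_mem_sigmaDomain (hK : K ≠ 0) {s : ℝ} (hs : s ∈ sigmaDomain K) :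
    0 < 1 - 2 * K * s :=
  exp_sigma hK hs ▸ Real.exp_pos _

theorem hasDerivAt_sigmaInv (hK : K ≠ 0) (t : ℝ) :
    HasDerivAt (sigmaInv K) (Real.exp (-2 * K * t)) t := by
  have h := ((((hasDerivAt_id t).const_mul (-2 * K)).exp.const_sub 1).div_const (2 * K))
  exact h.congr_deriv (by rw [id]; field_simp)

theorem hasDerivAt_sigma (hK : K ≠ 0) {s : ℝ} (hs : s ∈ sigmaDomain K) :
    HasDerivAt (sigma K) (1 - 2 * K * s)⁻¹ s := by
  have h0 := (one_sub_pos_of_mem_sigmaDomain hK hs).ne'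
  have h := ((((hasDerivAt_id s).const_mul (2 * K)).const_sub 1).log h0).const_mul (-(1 / (2 * K)))
  exact h.congr_deriv (by rw [id]; field_simp)

theorem strictMono_sigmaInv (hK : K ≠ 0) : StrictMono (sigmaInv K) :=
  strictMono_of_hasDerivAt_pos (hasDerivAt_sigmaInv hK) fun _ ↦ Real.exp_pos _

theorem sigmaInv_zero (K : ℝ) : sigmaInv K 0 = 0 := by simp [sigmaInv]

theorem contDiffOn_sigma (hK : K ≠ 0) : ContDiffOn ℝ ∞ (sigma K) (sigmaDomain K) := by
  unfold sigma
  refine contDiffOn_const.mul (ContDiffOn.log (by fun_prop) fun s hs ↦ ?_)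
  exact (one_sub_pos_of_mem_sigmaDomain hK hs).ne'

/-- `⊥` is excluded because `EReal.toReal` sends it to `0`, making the transformed end time `0`. -/
theorem sigmaInv_lt_sigmaInvEnd_iff (hK : K ≠ 0) {T : EReal} (hT : T ≠ ⊥) (t : ℝ) :
    ((sigmaInv K t : ℝ) : EReal) < sigmaInvEnd K T ↔ (t : EReal) < T := by
  induction T with
  | bot => exact absurd rfl hT
  | top =>
    have h : sigmaInv K t ∈ sigmaDomain K := (sigmaInv_spec hK).1 (mem_univ t)
    simp only [EReal.coe_lt_top, iff_true, sigmaInvEnd, if_true]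
    unfold sigmaDomain at h
    split_ifs at h ⊢ with hpos
    · exact EReal.coe_lt_coe_iff.2 h
    · exact EReal.coe_lt_top _
  | coe T =>
    simp [sigmaInvEnd, (strictMono_sigmaInv hK).lt_iff_lt]

theorem sigmaInv_mem_timeInterval_iff (hK : K ≠ 0) {T : EReal} (hT : T ≠ ⊥) {t : ℝ} :
    sigmaInv K t ∈ timeInterval (sigmaInvEnd K T) ↔ t ∈ timeInterval T := by
  refine and_congr ?_ (sigmaInv_lt_sigmaInvEnd_iff hK hT t)
  rw [← (strictMono_sigmaInv hK).le_iff_le (a := 0) (b := t), sigmaInv_zero]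

theorem timeInterval_sigmaInvEnd_subset (hK : K ≠ 0) (T : EReal) :
    timeInterval (sigmaInvEnd K T) ⊆ sigmaDomain K := by
  rintro s ⟨hs0, hs⟩
  unfold sigmaDomain
  split_ifs with hpos
  · by_cases hT : T = ⊤
    · rw [sigmaInvEnd, if_pos hT, if_pos hpos] at hs
      exact EReal.coe_lt_coe_iff.1 hs
    · have h : sigmaInv K T.toReal ∈ sigmaDomain K := (sigmaInv_spec hK).1 (mem_univ _)
      rw [sigmaDomain, if_pos hpos] at h
      rw [sigmaInvEnd, if_neg hT] at hs
      exact (EReal.coe_lt_coe_iff.1 hs).trans h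
  · have hneg : K < 0 := lt_of_le_of_ne (not_lt.1 hpos) hK
    exact (one_div_neg.2 (by linarith)).trans_le hs0

theorem mapsTo_sigma (hK : K ≠ 0) {T : EReal} (hT : T ≠ ⊥) :
    MapsTo (sigma K) (timeInterval (sigmaInvEnd K T)) (timeInterval T) := by
  intro s hs
  rw [← sigmaInv_mem_timeInterval_iff hK hT,
    sigmaInv_sigma hK (timeInterval_sigmaInvEnd_subset hK T hs)]
  exact hs

theorem mapsTo_sigmaInv (hK : K ≠ 0) {T : EReal} (hT : T ≠ ⊥) :
    MapsTo (sigmaInv K) (timeInterval T) (timeInterval (sigmaInvEnd K T)) :=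
  fun _ ht ↦ (sigmaInv_mem_timeInterval_iff hK hT).2 ht

/-- The factor `1 - 2Ks` cancels `σ'`, and its own derivative supplies the term `-2K f`. -/
theorem HasDerivWithinAt.rescale_comp_sigma (hK : K ≠ 0) {T : EReal} (hT : T ≠ ⊥) {f : ℝ → ℝ}
    {h s : ℝ} (hs : s ∈ timeInterval (sigmaInvEnd K T))
    (hf : HasDerivWithinAt f h (timeInterval T) (sigma K s)) :
    HasDerivWithinAt (fun r ↦ Real.exp (-2 * K * sigma K r) * f (sigma K r))
      (h - 2 * K * f (sigma K s)) (timeInterval (sigmaInvEnd K T)) s := by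
  have hJ := timeInterval_sigmaInvEnd_subset hK T
  have hlin : HasDerivWithinAt (fun r ↦ 1 - 2 * K * r) (-(2 * K))
      (timeInterval (sigmaInvEnd K T)) s := by
    simpa using (((hasDerivAt_id s).const_mul (2 * K)).const_sub 1).hasDerivWithinAt
  have hcomp := hf.comp s (hasDerivAt_sigma hK (hJ hs)).hasDerivWithinAt (mapsTo_sigma hK hT)
  refine ((hlin.mul hcomp).congr (fun r hr ↦ ?_) ?_).congr_deriv ?_
  · simp only [Pi.mul_apply, Function.comp_apply, exp_sigma hK (hJ hr)]
  · simp only [Pi.mul_apply, Function.comp_apply, exp_sigma hK (hJ hs)]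
  · have h0 := (one_sub_pos_of_mem_sigmaDomain hK (hJ hs)).ne'
    simp only [Function.comp_apply]
    field_simp
    ring

/-- Composing with `σ⁻¹` and multiplying by `exp (2Kt)` recovers `f`, so its differentiability is a
conclusion. -/
theorem HasDerivWithinAt.of_rescale_comp_sigma (hK : K ≠ 0) {T : EReal} (hT : T ≠ ⊥) {f : ℝ → ℝ}
    {d t : ℝ}
    (hf : HasDerivWithinAt (fun r ↦ Real.exp (-2 * K * sigma K r) * f (sigma K r)) d
      (timeInterval (sigmaInvEnd K T)) (sigmaInv K t)) :
    HasDerivWithinAt f (d + 2 * K * f t) (timeInterval T) t := by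
  have hexp : HasDerivWithinAt (fun r ↦ Real.exp (2 * K * r)) (Real.exp (2 * K * t) * (2 * K))
      (timeInterval T) t := by
    simpa using ((hasDerivAt_id t).const_mul (2 * K)).exp.hasDerivWithinAt
  have hcomp := hf.comp t (hasDerivAt_sigmaInv hK t).hasDerivWithinAt (mapsTo_sigmaInv hK hT)
  have hcancel : ∀ r, Real.exp (2 * K * r) * Real.exp (-2 * K * r) = 1 := fun r ↦ by
    rw [← Real.exp_add]; simp
  refine ((hexp.mul hcomp).congr (fun r _ ↦ ?_) ?_).congr_deriv ?_
  · simp only [Pi.mul_apply, Function.comp_apply, sigma_sigmaInv hK]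
    rw [← mul_assoc, hcancel, one_mul]
  · simp only [Pi.mul_apply, Function.comp_apply, sigma_sigmaInv hK]
    rw [← mul_assoc, hcancel, one_mul]
  · simp only [Function.comp_apply, sigma_sigmaInv hK]
    linear_combination (2 * K * f t + d) * hcancel t

end TimeChange

/-! ### Joint smoothness of the rescaled family. -/

section Smoothness

/-- Scalar multiples of a section along a map into the base of a vector bundle are smooth. -/
theorem ContMDiffWithinAt.smul_totalSpace {EN HN N EB HB B F : Type*}
    [NormedAddCommGroup EN] [NormedSpace ℝ EN] [TopologicalSpace HN] {IN : ModelWithCorners ℝ EN HN}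
    [TopologicalSpace N] [ChartedSpace HN N]
    [NormedAddCommGroup EB] [NormedSpace ℝ EB] [TopologicalSpace HB] {IB : ModelWithCorners ℝ EB HB}
    [TopologicalSpace B] [ChartedSpace HB B]
    [NormedAddCommGroup F] [NormedSpace ℝ F] {E : B → Type*} [TopologicalSpace (TotalSpace F E)]
    [∀ x, AddCommGroup (E x)] [∀ x, Module ℝ (E x)] [∀ x, TopologicalSpace (E x)]
    [FiberBundle F E] [VectorBundle ℝ F E] {k : WithTop ℕ∞} {u : Set N} {p : N} {f : N → B}
    {s : ∀ q, E (f q)} {c : N → ℝ} (hc : ContMDiffWithinAt IN 𝓘(ℝ, ℝ) k c u p)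
    (hs : ContMDiffWithinAt IN (IB.prod 𝓘(ℝ, F)) k (fun q ↦ TotalSpace.mk' F (f q) (s q)) u p) :
    ContMDiffWithinAt IN (IB.prod 𝓘(ℝ, F)) k
      (fun q ↦ TotalSpace.mk' F (f q) (c q • s q)) u p := by
  rw [Bundle.contMDiffWithinAt_totalSpace] at hs ⊢
  have hp := FiberBundle.mem_baseSet_trivializationAt' (F := F) (E := E) (f p)
  refine ⟨hs.1, (hc.smul hs.2).congr_of_eventuallyEq ?_ ?_⟩
  -- The trivialization is linear only on fibres over its base set, which `f` reaches near `p` by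
  -- continuity.
  · filter_upwards [hs.1.continuousWithinAt.eventually
      ((trivializationAt F E (f p)).open_baseSet.mem_nhds hp)] with q hq
    exact ((trivializationAt F E (f p)).linear ℝ hq).2 (c q) (s q)
  · exact ((trivializationAt F E (f p)).linear ℝ hp).2 (c p) (s p)

variable {n : ℕ} {M : Type*} [TopologicalSpace M]
  [ChartedSpace (EuclideanSpace ℝ (Fin n)) M] [IsManifold (𝓡 n) ∞ M]

/-- Reparametrising time smoothly and multiplying by a smooth positive function of time preserves
smooth time dependence. -/
theorem IsTimeDependentMetric.scale_comp {I I' : Set ℝ} {g : ℝ → SmoothMetric n M}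
    (hg : IsTimeDependentMetric I g) {φ c : ℝ → ℝ} (hφ : ContDiffOn ℝ ∞ φ I') (hI : MapsTo φ I' I)
    (hc : ContDiffOn ℝ ∞ c I') (hpos : ∀ s, 0 < c s) :
    IsTimeDependentMetric I' fun s ↦ (g (φ s)).scale (c s) (hpos s) := by
  have hfst : MapsTo (Prod.fst : ℝ × M → ℝ) (I' ×ˢ univ) I' := fun p hp ↦ hp.1
  have hφ' : ContMDiffOn (𝓘(ℝ, ℝ).prod (𝓡 n)) (𝓘(ℝ, ℝ).prod (𝓡 n)) ∞
      (fun p : ℝ × M ↦ (φ p.1, p.2)) (I' ×ˢ univ) :=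
    (hφ.contMDiffOn.comp contMDiffOn_fst hfst).prodMk contMDiffOn_snd
  have hc' : ContMDiffOn (𝓘(ℝ, ℝ).prod (𝓡 n)) 𝓘(ℝ, ℝ) ∞ (fun p : ℝ × M ↦ c p.1) (I' ×ˢ univ) :=
    hc.contMDiffOn.comp contMDiffOn_fst hfst
  have hcomp := ContMDiffOn.comp (f := fun p : ℝ × M ↦ (φ p.1, p.2)) hg hφ'
    fun p hp ↦ ⟨hI hp.1, mem_univ _⟩
  exact fun p hp ↦ (hc' p hp).smul_totalSpace (hcomp p hp)

end Smoothness

theorem lemma5p1 {n : ℕ} {M : Type*} [TopologicalSpace M] [T2Space M] [SecondCountableTopology M]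
    [ChartedSpace (EuclideanSpace ℝ (Fin n)) M] [IsManifold (𝓡 n) ∞ M]
    (K : ℝ) (hK : K ≠ 0) (T : EReal) (hT : 0 < T) (g : ℝ → SmoothMetric n M)
    (hg : IsTimeDependentMetric (timeInterval T) g) :
    IsKRicciFlow K (timeInterval T) g ↔
      IsRicciFlow (timeInterval (sigmaInvEnd K T)) (rescaledMetric K g) := by
  have hT' : T ≠ ⊥ := (bot_lt_iff_ne_bot.1 (bot_le.trans_lt hT))
  have hJ := timeInterval_sigmaInvEnd_subset hK T
  constructor
  · refine fun h ↦ ⟨?_, fun s hs x v w ↦ ?_⟩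
    · have hσ := (contDiffOn_sigma hK).mono hJ
      exact hg.scale_comp hσ (mapsTo_sigma hK hT') (contDiffOn_const.mul hσ).exp _
    · obtain ⟨d, hd, hflow⟩ := h.evolution _ (mapsTo_sigma hK hT' hs) x v w
      refine (hd.rescale_comp_sigma hK hT' hs).congr_deriv ?_
      rw [rescaledMetric, ricci_scale]
      linarith
  · refine fun h ↦ ⟨hg, fun t ht x v w ↦ ?_⟩
    have hd := h.evolution _ (mapsTo_sigmaInv hK hT' ht) x v w
    -- The witness for `∂_t g` is `-2 Ric + 2K g`, with `Ric` still that of the rescaled metric.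
    refine ⟨_, HasDerivWithinAt.of_rescale_comp_sigma hK hT' (f := fun r ↦ (g r).inner x v w)
      hd, ?_⟩
    rw [rescaledMetric, ricci_scale, sigma_sigmaInv hK]
    ring
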